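/- Let $G$ be a finitely generated group and $H$ a finitely generated subgroup. For a subgroup $K\le G$, a subset $W\subseteq G$ is \emph{$K$-finite} if it lies in a finite union of cosets $Kg$; two subsets are \emph{$K$-almost equal} if their symmetric difference is $K$-finite. A subset $U\subseteq G$, with complement $U^*=G-U$, is \emph{$K$-almost invariant} if $kU=U$ for all $k\in K$ and the subset $K\backslash U$ of $K\backslash G$ has finite symmetric difference with its right translate $(K\backslash U)a$ for every $a\in G$; it is \emph{nontrivial} if $K\backslash U$ and $K\backslash U^*$ are both infinite. If $U$ is $K$-almost invariant and $W$ is $L$-almost invariant, then $U$ and $W$ are \emph{equivalent}, $U\sim W$, if they are $K$-almost equal. For $U$ nontrivial over $K$ and $W$ nontrivial over $L$, the set $U\cap W$ is \emph{small} if it is $K$-finite. (For nontrivial sets these two notions do not depend on the choice of $K$ and $L$.) The \emph{corners} of $(U,W)$ are $U\cap W$, $U\cap W^*$, $U^*\cap W$, $U^*\cap W^*$. Write $E(U)=\{gU,\,gU^*: g\in G\}$. The set $U$ is in \emph{good position} if, whenever two of the corners of a pair of elements of $E(U)$ are small, one of the corners of that pair is empty; it is \emph{invertible} if $gU=U^*$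 for some $g\in G$. For $A,B\in E(U)$ write $A\le B$ if $A\cap B^*$ is empty or is the only small one among the four corners of $(A,B)$. Let $X$ be a nontrivial $H$-almost invariant subset of $G$, let $\mathcal K$ be the subgroup $\{g\in G: gX\sim X\text{ or }gX\sim X^*\}$ of $G$, and let $Y$, $Z$, $V$ be almost invariant subsets of $G$ (over some subgroups), each equivalent to $X$, each in good position and each invertible. Then $\le$ is a partial order on each of $E(Y)$, $E(Z)$, $E(V)$, and one of the following holds: 1. between any two of $E(Y)$, $E(Z)$, $E(V)$ there is a $G$-equivariant bijection $\varphi$ which preserves complementation, the order ($A\le B$ if and only if $\varphi(A)\le\varphi(B)$) and equivalence classes ($\varphi(A)\sim A$ for all $A$); 2. $H$ has infinite index in $\mathcal K$, and there is such a bijection between at least two of $E(Y)$, $E(Z)$, $E(V)$. In particular, since in either case two of any three such posets are isomorphic in this sense, at most two partially ordered sets, up to such isomorphism, arise from invertible sets in good position that are equivalent to $X$. -/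

import Mathlib

open scoped Pointwise symmDiff

namespace AlmostInvariant

variable {G : Type*} [Group G]

/-- The right translate `X a` of a subset `X` of `G`. -/
def rightTranslate (X : Set G) (a : G) : Set G := (fun x => x * a) '' X

/-- The image `H \ X` of `X` in the set `H \ G` of cosets `H g`. -/
def cosetImage (H : Subgroup G) (X : Set G) : Set (Quotient (QuotientGroup.rightRel H)) :=
  (fun x => Quotient.mk (QuotientGroup.rightRel H) x) '' X

/-- `X` is `H`-almost invariant: it is invariant under the left action of `H`, and `H \ X` is an
almost invariant subset of `H \ G`, i.e. `(H \ X) a = H \ (X a)` and `H \ X` have finite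
symmetric difference for all `a` in `G`. -/
def IsAI (H : Subgroup G) (X : Set G) : Prop :=
  (∀ h ∈ H, h • X = X) ∧
    ∀ a : G, (cosetImage H (rightTranslate X a) ∆ cosetImage H X).Finite

/-- `X` is a nontrivial `H`-almost invariant set: `H \ X` and `H \ X*` are also infinite. -/
def IsNontrivialAI (H : Subgroup G) (X : Set G) : Prop :=
  IsAI H X ∧ (cosetImage H X).Infinite ∧ (cosetImage H Xᶜ).Infinite

/-- `W` is `H`-finite: it is contained in the union of finitely many cosets `H g`. -/
def HFinite (H : Subgroup G) (W : Set G) : Prop :=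
  ∃ F : Set G, F.Finite ∧ W ⊆ (H : Set G) * F

/-- `U` and `V` are `H`-almost equal. -/
def AlmostEq (H : Subgroup G) (U V : Set G) : Prop := HFinite H (U ∆ V)

/-- `X` and `Y` are equivalent: `X` is `H`-almost invariant and `Y` is `K`-almost invariant for
some subgroups `H` and `K`, and they are `H`-almost equal. For nontrivial `X` this does not
depend on the choice of `H` and `K`. -/
def Equivalent (X Y : Set G) : Prop :=
  ∃ H K : Subgroup G, IsAI H X ∧ IsAI K Y ∧ AlmostEq H X Y

/-- For nontrivial almost invariant sets `U` (over `H`) and `V` (over `K`): the intersection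
`U ∩ V` is small, i.e. `H`-finite. This does not depend on the choice of `H` and `K`. -/
def SmallInter (U V : Set G) : Prop :=
  ∃ H K : Subgroup G, IsNontrivialAI H U ∧ IsNontrivialAI K V ∧ HFinite H (U ∩ V)

/-- `X` or its complement. -/
def side (X : Set G) (b : Bool) : Set G := if b then X else Xᶜ

/-- The set `E(X)` of all translates of `X` and `X*`. -/
def E (X : Set G) : Set (Set G) := {A | ∃ g : G, A = g • X ∨ A = g • Xᶜ}

/-- `X` is in good position: if `U` and `V` are in `E(X)` and two of their four corners are
small, then one of their corners is empty. -/
def GoodPosition (X : Set G) : Prop :=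
  ∀ U ∈ E X, ∀ V ∈ E X,
    (∃ i j : Bool × Bool, i ≠ j ∧ SmallInter (side U i.1) (side V i.2) ∧
      SmallInter (side U j.1) (side V j.2)) →
    ∃ i : Bool × Bool, side U i.1 ∩ side V i.2 = ∅

/-- `U ≤ V`: the corner `U ∩ V*` is empty, or is the only small one among the four corners. -/
def AlmostLE (U V : Set G) : Prop :=
  U ∩ Vᶜ = ∅ ∨
    (SmallInter U Vᶜ ∧ ¬ SmallInter U V ∧ ¬ SmallInter Uᶜ V ∧ ¬ SmallInter Uᶜ Vᶜ)

/-- `X` is invertible: `g X = X*` for some `g` in `G`. -/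
def IsInvertible (X : Set G) : Prop := ∃ g : G, g • X = Xᶜ

theorem smul_mem_E {X A : Set G} (g : G) (hA : A ∈ E X) : g • A ∈ E X := by
  obtain ⟨k, rfl | rfl⟩ := hA
  · exact ⟨g * k, Or.inl (smul_smul _ _ _)⟩
  · exact ⟨g * k, Or.inr (smul_smul _ _ _)⟩

theorem compl_mem_E {X A : Set G} (hA : A ∈ E X) : Aᶜ ∈ E X := by
  obtain ⟨k, rfl | rfl⟩ := hA
  · exact ⟨k, Or.inr (Set.smul_set_compl).symm⟩
  · exact ⟨k, Or.inl (by rw [Set.smul_set_compl, compl_compl])⟩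

/-- The action of `G` on `E(X)` by left translation. -/
instance instMulActionE (X : Set G) : MulAction G (E X) where
  smul g A := ⟨g • (A : Set G), smul_mem_E g A.2⟩
  one_smul A := Subtype.ext (one_smul G (A : Set G))
  mul_smul g k A := Subtype.ext (mul_smul g k (A : Set G))

/-- The complementation of `E(X)`. -/
def starE {X : Set G} (A : E X) : E X := ⟨(A : Set G)ᶜ, compl_mem_E A.2⟩

/-- There is a `G`-equivariant bijection `E(Y) → E(Z)` which preserves complementation, the
ordering `≤` and equivalence classes. -/
def SamePoset (Y Z : Set G) : Prop :=
  ∃ φ : E Y ≃ E Z,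
    (∀ (g : G) (A : E Y), φ (g • A) = g • φ A) ∧
    (∀ A : E Y, φ (starE A) = starE (φ A)) ∧
    (∀ A B : E Y, AlmostLE (A : Set G) B ↔ AlmostLE (φ A : Set G) (φ B)) ∧
    ∀ A : E Y, Equivalent (A : Set G) (φ A)

/-! Facts needed to see that `𝒦(X)` is a subgroup. -/

theorem mem_cosets {H : Subgroup G} {F : Set G} {w : G} :
    w ∈ (H : Set G) * F ↔ ∃ f ∈ F, w * f⁻¹ ∈ H := by
  constructor
  · rintro ⟨h, hh, f, hf, rfl⟩
    exact ⟨f, hf, by simpa using hh⟩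
  · rintro ⟨f, hf, h⟩
    exact ⟨w * f⁻¹, h, f, hf, by simp⟩

theorem hFinite_iff {H : Subgroup G} {W : Set G} : HFinite H W ↔ (cosetImage H W).Finite := by
  constructor
  · rintro ⟨F, hF, hW⟩
    refine (hF.image (fun x => Quotient.mk (QuotientGroup.rightRel H) x)).subset ?_
    rintro _ ⟨w, hw, rfl⟩
    obtain ⟨f, hf, h⟩ := mem_cosets.1 (hW hw)
    exact ⟨f, hf, Quotient.sound (QuotientGroup.rightRel_apply.2 h)⟩
  · intro h
    refine ⟨Quotient.out '' cosetImage H W, h.image _, fun w hw => mem_cosets.2 ?_⟩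
    refine ⟨_, ⟨_, ⟨w, hw, rfl⟩, rfl⟩, ?_⟩
    exact QuotientGroup.rightRel_apply.1 (Quotient.mk_out (s := QuotientGroup.rightRel H) w)

theorem HFinite.mono {H : Subgroup G} {U W : Set G} (h : HFinite H W) (hU : U ⊆ W) :
    HFinite H U :=
  let ⟨F, hF, hW⟩ := h
  ⟨F, hF, hU.trans hW⟩

theorem HFinite.union {H : Subgroup G} {U W : Set G} (h : HFinite H U) (h' : HFinite H W) :
    HFinite H (U ∪ W) := by
  rw [hFinite_iff] at *
  rw [cosetImage, Set.image_union]
  exact h.union h'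

theorem HFinite.trans {H K : Subgroup G} {W : Set G} (h : HFinite H W) (h' : HFinite K (H : Set G)) :
    HFinite K W := by
  obtain ⟨F, hF, hW⟩ := h
  obtain ⟨F', hF', hH⟩ := h'
  refine ⟨F' * F, hF'.mul hF, hW.trans ?_⟩
  rw [← mul_assoc]
  exact Set.mul_subset_mul_right hH

theorem HFinite.right {H : Subgroup G} {W : Set G} (h : HFinite H W) (a : G) :
    HFinite H (rightTranslate W a) := by
  obtain ⟨F, hF, hW⟩ := h
  refine ⟨rightTranslate F a, hF.image _, ?_⟩
  rintro _ ⟨w, hw, rfl⟩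
  obtain ⟨f, hf, h⟩ := mem_cosets.1 (hW hw)
  exact mem_cosets.2 ⟨f * a, ⟨f, hf, rfl⟩, by simpa [mul_assoc] using h⟩

theorem mem_rightTranslate {X : Set G} {a x : G} : x ∈ rightTranslate X a ↔ x * a⁻¹ ∈ X := by
  constructor
  · rintro ⟨y, hy, rfl⟩
    simpa using hy
  · intro h
    exact ⟨_, h, by simp⟩

theorem inv_iff {H : Subgroup G} {X : Set G} (hX : ∀ h ∈ H, h • X = X) {h : G} (hh : h ∈ H)
    {x : G} : h * x ∈ X ↔ x ∈ X := by
  conv_lhs => rw [← hX h hh]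
  exact Set.smul_mem_smul_set_iff (a := h) (x := x)

theorem mk_mem_cosetImage {H : Subgroup G} {X : Set G} (hX : ∀ h ∈ H, h • X = X) {x : G} :
    Quotient.mk (QuotientGroup.rightRel H) x ∈ cosetImage H X ↔ x ∈ X := by
  constructor
  · rintro ⟨y, hy, h⟩
    have := QuotientGroup.rightRel_apply.1 (Quotient.exact h)
    rw [← inv_iff hX this] at hy
    simpa using hy
  · intro h
    exact ⟨x, h, rfl⟩

theorem inv_right {H : Subgroup G} {X : Set G} (hX : ∀ h ∈ H, h • X = X) (a : G) :
    ∀ h ∈ H, h • rightTranslate X a = rightTranslate X a := by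
  intro h hh
  ext x
  rw [Set.mem_smul_set_iff_inv_smul_mem, mem_rightTranslate, mem_rightTranslate, smul_eq_mul,
    mul_assoc, inv_iff hX (H.inv_mem hh)]

/-- `X` is `H`-almost invariant if and only if it is left `H`-invariant and `X a` is `H`-almost
equal to `X` for all `a` in `G`. -/
theorem isAI_iff {H : Subgroup G} {X : Set G} :
    IsAI H X ↔ (∀ h ∈ H, h • X = X) ∧ ∀ a : G, AlmostEq H (rightTranslate X a) X := by
  refine and_congr_right fun hX => forall_congr' fun a => ?_
  rw [AlmostEq, hFinite_iff]
  refine iff_of_eq (congrArg Set.Finite ?_)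
  ext q
  induction q using Quotient.inductionOn with | _ x => ?_
  have hs : ∀ h ∈ H, h • (rightTranslate X a ∆ X) = rightTranslate X a ∆ X := by
    intro h hh
    rw [Set.smul_set_symmDiff, inv_right hX a h hh, hX h hh]
  rw [mk_mem_cosetImage hs, Set.mem_symmDiff, Set.mem_symmDiff, mk_mem_cosetImage hX,
    mk_mem_cosetImage (inv_right hX a)]

theorem AlmostEq.trans {H : Subgroup G} {U V W : Set G} (h : AlmostEq H U V)
    (h' : AlmostEq H V W) : AlmostEq H U W :=
  (HFinite.union h h').mono (symmDiff_triangle U V W)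

theorem AlmostEq.symm {H : Subgroup G} {U V : Set G} (h : AlmostEq H U V) : AlmostEq H V U := by
  rwa [AlmostEq, symmDiff_comm]

theorem AlmostEq.compl {H : Subgroup G} {U V : Set G} (h : AlmostEq H U V) :
    AlmostEq H Uᶜ Vᶜ := by
  rwa [AlmostEq, compl_symmDiff_compl]

theorem AlmostEq.refl (H : Subgroup G) (U : Set G) : AlmostEq H U U :=
  ⟨∅, Set.finite_empty, by simp⟩

theorem rightTranslate_compl (X : Set G) (a : G) : rightTranslate Xᶜ a = (rightTranslate X a)ᶜ := by
  ext x
  simp [mem_rightTranslate]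

theorem rightTranslate_smul (X : Set G) (g a : G) :
    rightTranslate (g • X) a = g • rightTranslate X a := by
  ext x
  simp [mem_rightTranslate, Set.mem_smul_set_iff_inv_smul_mem, mul_assoc]

theorem IsAI.compl {H : Subgroup G} {X : Set G} (h : IsAI H X) : IsAI H Xᶜ := by
  rw [isAI_iff] at *
  refine ⟨fun k hk => by rw [Set.smul_set_compl, h.1 k hk], fun a => ?_⟩
  rw [rightTranslate_compl]
  exact (h.2 a).compl

theorem IsNontrivialAI.compl {H : Subgroup G} {X : Set G} (h : IsNontrivialAI H X) :
    IsNontrivialAI H Xᶜ :=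
  ⟨h.1.compl, h.2.2, by rw [compl_compl]; exact h.2.1⟩

/-- The conjugate subgroup `g H g⁻¹`. -/
def conjSubgroup (g : G) (H : Subgroup G) : Subgroup G := H.map (MulAut.conj g).toMonoidHom

theorem mem_conjSubgroup {g x : G} {H : Subgroup G} :
    x ∈ conjSubgroup g H ↔ g⁻¹ * x * g ∈ H := by
  constructor
  · rintro ⟨h, hh, rfl⟩
    simpa [mul_assoc] using hh
  · intro h
    exact ⟨_, h, by simp [mul_assoc]⟩

theorem hFinite_conj {g : G} {H : Subgroup G} {W : Set G} :
    HFinite (conjSubgroup g H) W ↔ HFinite H (g⁻¹ • W) := by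
  constructor
  · rintro ⟨F, hF, hW⟩
    refine ⟨g⁻¹ • F, hF.image _, ?_⟩
    rintro _ ⟨w, hw, rfl⟩
    obtain ⟨f, hf, h⟩ := mem_cosets.1 (hW hw)
    refine mem_cosets.2 ⟨g⁻¹ • f, Set.smul_mem_smul_set hf, ?_⟩
    simpa [mul_assoc] using mem_conjSubgroup.1 h
  · rintro ⟨F, hF, hW⟩
    refine ⟨g • F, hF.image _, fun w hw => ?_⟩
    obtain ⟨f, hf, h⟩ := mem_cosets.1 (hW (Set.smul_mem_smul_set hw))
    refine mem_cosets.2 ⟨g • f, Set.smul_mem_smul_set hf, mem_conjSubgroup.2 ?_⟩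
    simpa [mul_assoc] using h

theorem IsAI.conj {H : Subgroup G} {X : Set G} (h : IsAI H X) (g : G) :
    IsAI (conjSubgroup g H) (g • X) := by
  rw [isAI_iff] at *
  refine ⟨fun k hk => ?_, fun a => ?_⟩
  · have := h.1 _ (mem_conjSubgroup.1 hk)
    rw [← smul_eq_mul, ← smul_eq_mul, smul_assoc, smul_assoc, inv_smul_eq_iff] at this
    exact this
  · rw [AlmostEq, hFinite_conj, rightTranslate_smul, ← Set.smul_set_symmDiff, inv_smul_smul]
    exact h.2 a

theorem IsNontrivialAI.conj {H : Subgroup G} {X : Set G} (h : IsNontrivialAI H X) (g : G) :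
    IsNontrivialAI (conjSubgroup g H) (g • X) := by
  refine ⟨h.1.conj g, ?_, ?_⟩
  · rw [Set.Infinite, ← hFinite_iff, hFinite_conj, inv_smul_smul, hFinite_iff]
    exact h.2.1
  · rw [Set.Infinite, ← hFinite_iff, hFinite_conj, ← Set.smul_set_compl, inv_smul_smul,
      hFinite_iff]
    exact h.2.2

/-- Equivalent almost invariant sets, the first nontrivial, are over commensurable subgroups. -/
theorem comm_aux {H K : Subgroup G} {X Y : Set G} (hX : IsNontrivialAI H X) (hY : IsAI K Y)
    (h : AlmostEq H X Y) : HFinite K (H : Set G) ∧ HFinite H (K : Set G) := by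
  obtain ⟨⟨hX0, hi, hi'⟩, hY0⟩ := And.intro hX (isAI_iff.1 hY)
  have hX1 := isAI_iff.1 hX0
  have pick : ∀ A B : Set G, (∀ k ∈ H, k • A = A) → (cosetImage H A).Infinite →
      HFinite H (A ∆ B) → ∃ p, ∀ k ∈ H, k * p ∈ B := by
    intro A B hA hAi hAB
    obtain ⟨F, hF, hs⟩ := hAB
    have : ¬ A ⊆ (H : Set G) * F := fun hc => hAi (hFinite_iff.1 ⟨F, hF, hc⟩)
    obtain ⟨p, hp, hpF⟩ := Set.not_subset.1 this
    refine ⟨p, fun k hk => ?_⟩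
    by_contra hB
    apply hpF
    obtain ⟨f, hf, hm⟩ := mem_cosets.1
      (hs (Set.mem_symmDiff.2 (Or.inl ⟨(inv_iff hA hk).2 hp, hB⟩)))
    refine mem_cosets.2 ⟨f, hf, ?_⟩
    rw [mul_assoc] at hm
    exact (H.mul_mem_cancel_left hk).1 hm
  obtain ⟨p, hp⟩ := pick X Y hX1.1 hi h
  obtain ⟨q, hq⟩ := pick Xᶜ Yᶜ hX0.compl.1 hi' h.compl
  have back : ∀ {L M : Subgroup G}, HFinite L (rightTranslate (M : Set G) p) →
      HFinite L (M : Set G) := by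
    intro L M hL
    refine (hL.right p⁻¹).mono fun x hx => ?_
    rw [mem_rightTranslate, mem_rightTranslate]
    simpa using hx
  have key : ∀ k : G, k * p ∈ rightTranslate Y (q⁻¹ * p) ↔
      k * q ∈ Y := by
    intro k
    rw [mem_rightTranslate]
    simp [mul_assoc]
  have hmem : ∀ k ∈ H, k * p ∈ rightTranslate Y (q⁻¹ * p) ∆ Y := fun k hk =>
    Set.mem_symmDiff.2 (Or.inr ⟨hp k hk, fun hc => hq k hk ((key k).1 hc)⟩)
  refine ⟨back ((hY0.2 (q⁻¹ * p)).mono ?_), back (HFinite.mono (W :=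
    rightTranslate Y (q⁻¹ * p) ∆ Y) ?_ ?_)⟩
  · rintro _ ⟨k, hk, rfl⟩
    exact hmem k hk
  · have h1 : AlmostEq H (rightTranslate Y (q⁻¹ * p)) (rightTranslate X (q⁻¹ * p)) := by
      refine (HFinite.right h.symm (q⁻¹ * p)).mono fun x hx => ?_
      simpa only [Set.mem_symmDiff, mem_rightTranslate] using hx
    exact (h1.trans (hX1.2 _)).trans h
  · rintro _ ⟨k, hk, rfl⟩
    have hs : k • (rightTranslate Y (q⁻¹ * p) ∆ Y) = rightTranslate Y (q⁻¹ * p) ∆ Y := by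
      rw [Set.smul_set_symmDiff, inv_right hY0.1 _ k hk, hY0.1 k hk]
    have := hmem 1 H.one_mem
    rw [one_mul] at this
    rw [← hs]
    exact Set.smul_mem_smul_set this

theorem equivalent_smul_iff {H : Subgroup G} {X Y : Set G} (hX : IsNontrivialAI H X)
    (hY : IsNontrivialAI H Y) (g : G) :
    Equivalent (g • X) Y ↔
      (∀ W : Set G, HFinite H (g⁻¹ • W) ↔ HFinite H W) ∧ AlmostEq H (g • X) Y := by
  constructor
  · rintro ⟨H₁, K₁, h1, h2, h3⟩
    have a1 := comm_aux (hX.conj g) h1 (AlmostEq.refl _ _)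
    have h3' : AlmostEq (conjSubgroup g H) (g • X) Y := HFinite.trans h3 a1.2
    have a2 := comm_aux (hX.conj g) h2 h3'
    have a3 := comm_aux hY h2 (AlmostEq.refl _ _)
    have hW : ∀ W : Set G, HFinite H (g⁻¹ • W) ↔ HFinite H W := fun W => by
      rw [← hFinite_conj]
      exact ⟨fun hw => (hw.trans a2.1).trans a3.2, fun hw => (hw.trans a3.1).trans a2.2⟩
    exact ⟨hW, (hW _).1 (hFinite_conj.1 h3')⟩
  · rintro ⟨hW, h⟩
    exact ⟨conjSubgroup g H, H, hX.1.conj g, hY.1, hFinite_conj.2 ((hW _).2 h)⟩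

theorem AlmostEq.smul {H : Subgroup G} {g : G} {U V : Set G}
    (hg : ∀ W : Set G, HFinite H (g⁻¹ • W) ↔ HFinite H W) (h : AlmostEq H U V) :
    AlmostEq H (g • U) (g • V) := by
  rw [AlmostEq, ← hg, ← Set.smul_set_symmDiff, inv_smul_smul]
  exact h

/-- The subgroup `𝒦(X) = {g ∈ G : g X ∼ X or g X ∼ X*}` of `G`, for a nontrivial `H`-almost
invariant set `X`. -/
def stabK {H : Subgroup G} {X : Set G} (hX : IsNontrivialAI H X) : Subgroup G where
  carrier := {g | Equivalent (g • X) X ∨ Equivalent (g • X) Xᶜ}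
  one_mem' := by
    left
    rw [equivalent_smul_iff hX hX]
    simpa using AlmostEq.refl H X
  mul_mem' := by
    intro a b ha hb
    simp only [Set.mem_ofPred_eq, equivalent_smul_iff hX hX, equivalent_smul_iff hX hX.compl,
      ← and_or_left] at *
    obtain ⟨ha, ha'⟩ := ha
    obtain ⟨hb, hb'⟩ := hb
    refine ⟨fun W => ?_, ?_⟩
    · rw [mul_inv_rev, mul_smul, hb, ha]
    · rw [mul_smul]
      rcases hb' with hb' | hb'
      · exact ha'.imp (hb'.smul ha).trans (hb'.smul ha).trans
      · have := hb'.smul ha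
        rw [Set.smul_set_compl] at this
        refine ha'.symm.imp (fun h => this.trans ?_) (fun h => this.trans h.compl)
        simpa using h.compl
  inv_mem' := by
    intro a ha
    simp only [Set.mem_ofPred_eq, equivalent_smul_iff hX hX, equivalent_smul_iff hX hX.compl,
      ← and_or_left] at *
    obtain ⟨ha, ha'⟩ := ha
    have hi : ∀ W : Set G, HFinite H (a⁻¹⁻¹ • W) ↔ HFinite H W := fun W => by
      rw [inv_inv, ← ha, inv_smul_smul]
    refine ⟨hi, ha'.imp (fun h => ?_) (fun h => ?_)⟩
    · have := (h.smul hi).symm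
      rwa [inv_smul_smul] at this
    · have := (h.smul hi).symm.compl
      rwa [inv_smul_smul, Set.smul_set_compl, compl_compl] at this

end AlmostInvariant

open AlmostInvariant

open scoped Pointwise symmDiff

namespace AlmostInvariant

variable {G : Type*} [Group G]

/-! On an equivalence class the order `≤` is inclusion; between inequivalent sets it is smallness of
a corner, which depends only on the two classes. So only the elements of `E(Y)` equivalent to `Y`
need care. Good position makes them a chain.

Let `S` be the stabilizer of `Y` and `K₀ = {k : kY ∼ Y}`. All sets in good position in the class
have the same `S` (`GoodPosition.smul_eq`), and all sets in the class have the same `K₀`. The signed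
number of `S`-cosets between `Y` and `kY` is a homomorphism `shift : K₀ → ℤ` with kernel `S`. It
depends only on the class of `Y`, and its sign tells which of `Y`, `kY` contains the other.
Conjugation by an element that inverts the class negates it (`shift_conj`).

Let `rY = Y*` and `tZ = Z*`. Then `r⁻¹t ∈ K₀`, and for `k ∈ K₀` with `shift (r⁻¹t) = -2 shift k` the
element `t` also inverts `kY`. Hence `g(kY) ↦ gZ` is the required bijection (`samePoset_of_shift`).
The only obstruction is thus the class of `shift (r⁻¹t)` modulo twice the cyclic image of `shift`.
For three sets these obstructions add up, so they cannot all be odd. If `H` has finite index in `𝒦`,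
then `shift` vanishes and there is no obstruction. -/

/-! ### Equivalence of almost invariant sets and independence of the subgroup -/

/-- `A` is a nontrivial almost invariant set over some subgroup. -/
def Nontriv (A : Set G) : Prop := ∃ K : Subgroup G, IsNontrivialAI K A

theorem Nontriv.compl {A : Set G} (h : Nontriv A) : Nontriv Aᶜ :=
  let ⟨K, hK⟩ := h
  ⟨K, hK.compl⟩

theorem Nontriv.smul {A : Set G} (h : Nontriv A) (g : G) : Nontriv (g • A) :=
  let ⟨_, hK⟩ := h
  ⟨_, hK.conj g⟩

theorem Nontriv.of_mem_E {A B : Set G} (h : Nontriv A) (hB : B ∈ E A) : Nontriv B := by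
  obtain ⟨g, rfl | rfl⟩ := hB
  · exact h.smul g
  · exact h.compl.smul g

theorem IsNontrivialAI.not_hFinite {H : Subgroup G} {A : Set G} (h : IsNontrivialAI H A) :
    ¬ HFinite H A := fun hc => h.2.1 (hFinite_iff.1 hc)

theorem hFinite_congr {H K : Subgroup G} {A B : Set G} (hA : IsNontrivialAI H A) (hB : IsAI K B)
    (h : AlmostEq H A B) (W : Set G) : HFinite H W ↔ HFinite K W :=
  ⟨fun hW => hW.trans (comm_aux hA hB h).1, fun hW => hW.trans (comm_aux hA hB h).2⟩

theorem hFinite_congr_self {H K : Subgroup G} {A : Set G} (hA : IsNontrivialAI H A)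
    (hB : IsAI K A) (W : Set G) : HFinite H W ↔ HFinite K W :=
  hFinite_congr hA hB (AlmostEq.refl _ _) W

theorem HFinite.of_almostEq {H : Subgroup G} {A B : Set G} (h : HFinite H A)
    (hAB : AlmostEq H A B) : HFinite H B := by
  refine (h.union hAB).mono fun x hx => ?_
  by_cases hA : x ∈ A
  · exact Or.inl hA
  · exact Or.inr (Set.mem_symmDiff.2 (Or.inr ⟨hx, hA⟩))

theorem IsNontrivialAI.of_almostEq {H K : Subgroup G} {A B : Set G} (hA : IsNontrivialAI H A)
    (hB : IsAI K B) (h : AlmostEq H A B) : IsNontrivialAI K B := by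
  refine ⟨hB, fun hc => ?_, fun hc => ?_⟩
  · rw [← hFinite_iff, ← hFinite_congr hA hB h] at hc
    exact hA.not_hFinite (hc.of_almostEq h.symm)
  · rw [← hFinite_iff, ← hFinite_congr hA hB h] at hc
    exact hA.compl.not_hFinite (hc.of_almostEq h.compl.symm)

theorem equivalent_iff {H K : Subgroup G} {A B : Set G} (hA : IsNontrivialAI H A)
    (hB : IsAI K B) : Equivalent A B ↔ AlmostEq H A B := by
  constructor
  · rintro ⟨H', K', h1, -, h3⟩
    exact (hFinite_congr_self hA h1 _).2 h3
  · exact fun h => ⟨H, K, hA.1, hB, h⟩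

theorem Nontriv.of_equivalent {A B : Set G} (hA : Nontriv A) (h : Equivalent A B) :
    Nontriv B := by
  obtain ⟨H, hA⟩ := hA
  obtain ⟨_, K, -, hB, -⟩ := id h
  exact ⟨K, hA.of_almostEq hB ((equivalent_iff hA hB).1 h)⟩

theorem Equivalent.refl_of {A : Set G} (hA : Nontriv A) : Equivalent A A :=
  let ⟨H, h⟩ := hA
  ⟨H, H, h.1, h.1, AlmostEq.refl _ _⟩

theorem Equivalent.symm {A B : Set G} (h : Equivalent A B) (hA : Nontriv A) :
    Equivalent B A := by
  obtain ⟨H, hA⟩ := hA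
  obtain ⟨_, K, -, hB, -⟩ := id h
  have h' := (equivalent_iff hA hB).1 h
  exact ⟨K, H, hB, hA.1, (hFinite_congr hA hB h' _).1 h'.symm⟩

theorem Equivalent.trans {A B C : Set G} (h : Equivalent A B) (h' : Equivalent B C)
    (hA : Nontriv A) : Equivalent A C := by
  obtain ⟨L, hB⟩ := hA.of_equivalent h
  obtain ⟨H, hA⟩ := hA
  obtain ⟨_, K, -, hC, -⟩ := id h'
  have h1 := (equivalent_iff hA hB.1).1 h
  have h2 := (equivalent_iff hB hC).1 h'
  exact ⟨H, K, hA.1, hC, h1.trans ((hFinite_congr hA hB.1 h1 _).2 h2)⟩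

theorem Equivalent.smul {A B : Set G} (h : Equivalent A B) (g : G) :
    Equivalent (g • A) (g • B) := by
  obtain ⟨H, K, hA, hB, h⟩ := h
  refine ⟨_, _, hA.conj g, hB.conj g, ?_⟩
  rw [AlmostEq, hFinite_conj, ← Set.smul_set_symmDiff, inv_smul_smul]
  exact h

theorem Equivalent.compl {A B : Set G} (h : Equivalent A B) : Equivalent Aᶜ Bᶜ := by
  obtain ⟨H, K, hA, hB, h⟩ := h
  exact ⟨_, _, hA.compl, hB.compl, h.compl⟩

theorem equivalent_smul_smul_iff {A B : Set G} (g h : G) :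
    Equivalent (g • A) (h • B) ↔ Equivalent ((h⁻¹ * g) • A) B := by
  constructor
  · intro H
    have := H.smul h⁻¹
    rwa [inv_smul_smul, ← mul_smul] at this
  · intro H
    have := H.smul h
    rwa [← mul_smul, mul_inv_cancel_left] at this

/-- For equivalent sets, the translates by `g` and `h` are equivalent for one if and only if
they are for the other. -/
theorem Equivalent.smul_congr {A B : Set G} (h : Equivalent A B) (hA : Nontriv A) {g k : G}
    (hg : Equivalent (g • A) (k • A)) : Equivalent (g • B) (k • B) :=
  have hB := hA.of_equivalent h
  (((h.symm hA).smul g).trans hg (hB.smul g)).trans (h.smul k) (hB.smul g)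

/-! ### Small intersections -/

theorem smallInter_iff {H K : Subgroup G} {A B : Set G} (hA : IsNontrivialAI H A)
    (hB : IsNontrivialAI K B) : SmallInter A B ↔ HFinite H (A ∩ B) := by
  constructor
  · rintro ⟨H', K', h1, -, h3⟩
    exact (hFinite_congr_self hA h1.1 _).2 h3
  · exact fun h => ⟨H, K, hA, hB, h⟩

theorem smallInter_of_eq_empty {A B : Set G} (hA : Nontriv A) (hB : Nontriv B)
    (h : A ∩ B = ∅) : SmallInter A B := by
  obtain ⟨H, hA⟩ := hA
  obtain ⟨K, hB⟩ := hB
  exact ⟨H, K, hA, hB, ∅, Set.finite_empty, by simp [h]⟩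

theorem smallInter_of_subset {A B : Set G} (hA : Nontriv A) (hB : Nontriv B)
    (h : A ⊆ B) : SmallInter A Bᶜ :=
  smallInter_of_eq_empty hA hB.compl (Set.sdiff_eq_empty.2 h)

/-- If `W` is `L`-finite and contained in `A`, and `P` is an `L`-invariant set that is not
`L`-finite but meets `A` in an `L`-finite set, then `W` is finite over each subgroup over which
`A` is almost invariant. -/
theorem hFinite_of_subset {L K : Subgroup G} {A P W : Set G} (hA : IsAI K A)
    (hP : ∀ l ∈ L, l • P = P) (hP' : ¬ HFinite L P) (hAP : HFinite L (P ∩ A))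
    (hW : HFinite L W) (hWA : W ⊆ A) : HFinite K W := by
  obtain ⟨F', hF', hs'⟩ := hAP
  have : ¬ P ⊆ (L : Set G) * F' := fun hc => hP' ⟨F', hF', hc⟩
  -- The whole coset `L u` lies in `P` and misses `A`.
  obtain ⟨u, hu, huF⟩ := Set.not_subset.1 this
  have hdis : ∀ l ∈ L, l * u ∉ A := by
    intro l hl hlA
    apply huF
    obtain ⟨f, hf, hm⟩ := mem_cosets.1 (hs' ⟨(inv_iff hP hl).2 hu, hlA⟩)
    refine mem_cosets.2 ⟨f, hf, ?_⟩
    rw [mul_assoc] at hm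
    exact (L.mul_mem_cancel_left hl).1 hm
  obtain ⟨F, hF, hs⟩ := hW
  have key : ∀ a : G, (cosetImage K (rightTranslate A a ∆ A)).Finite := fun a =>
    hFinite_iff.1 ((isAI_iff.1 hA).2 a)
  have hU : HFinite K (⋃ f ∈ F, (rightTranslate A (u⁻¹ * f) ∆ A)) := by
    rw [hFinite_iff, cosetImage, Set.image_iUnion₂]
    exact hF.biUnion fun f _ => key _
  -- Write `w = l f` with `l ∈ L`. Then `w ∈ A` while `w f⁻¹ u = l u ∉ A`, so `w` lies in the
  -- difference of `A` and its right translate by `u⁻¹ f`.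
  refine hU.mono fun w hw => ?_
  obtain ⟨f, hf, hm⟩ := mem_cosets.1 (hs hw)
  refine Set.mem_biUnion hf (Set.mem_symmDiff.2 (Or.inr ⟨hWA hw, fun hc => ?_⟩))
  rw [mem_rightTranslate] at hc
  refine hdis _ hm ?_
  simpa [mul_assoc] using hc

theorem SmallInter.symm {A B : Set G} (h : SmallInter A B) : SmallInter B A := by
  obtain ⟨H, K, hA, hB, h⟩ := h
  refine ⟨K, H, hB, hA, ?_⟩
  rw [Set.inter_comm]
  exact hFinite_of_subset hB.1 hA.1.1 hA.not_hFinite h h Set.inter_subset_right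

theorem not_smallInter_compl {A B : Set G} (h : SmallInter A B) : ¬ SmallInter A Bᶜ := by
  obtain ⟨H, K, hA, hB, h⟩ := h
  intro h'
  rw [smallInter_iff hA hB.compl] at h'
  refine hA.not_hFinite ((h.union h').mono ?_)
  rw [Set.inter_union_compl]

theorem equivalent_iff_smallInter {A B : Set G} (hA : Nontriv A) (hB : Nontriv B) :
    Equivalent A B ↔ SmallInter A Bᶜ ∧ SmallInter B Aᶜ := by
  obtain ⟨H, hA⟩ := hA
  obtain ⟨K, hB⟩ := hB
  have h2 : SmallInter B Aᶜ ↔ SmallInter Aᶜ B := ⟨SmallInter.symm, SmallInter.symm⟩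
  rw [equivalent_iff hA hB.1, h2, smallInter_iff hA hB.compl, smallInter_iff hA.compl hB]
  constructor
  · refine fun h => ⟨h.mono fun x hx => ?_, h.mono fun x hx => ?_⟩
    · exact Set.mem_symmDiff.2 (Or.inl hx)
    · exact Set.mem_symmDiff.2 (Or.inr hx.symm)
  · refine fun h => (h.1.union h.2).mono fun x hx => ?_
    exact (Set.mem_symmDiff.1 hx).imp id And.symm

/-- `A ∩ C*` is covered by `A ∩ B*` and `B ∩ C*`, hence finite over the subgroup of `B`. Since it
lies in `A`, `hFinite_of_subset` with `P = B*` carries this over to the subgroup of `A`. -/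
theorem SmallInter.trans {A B C : Set G} (h : SmallInter A Bᶜ) (h' : SmallInter B Cᶜ) :
    SmallInter A Cᶜ := by
  have hs := h.symm
  obtain ⟨H, K, hA, hB', -⟩ := id h
  obtain ⟨L, M, hB, hC, hBC⟩ := h'
  have hs' := (smallInter_iff hB.compl hA).1 hs
  refine ⟨H, M, hA, hC, ?_⟩
  refine hFinite_of_subset hA.1 hB.compl.1.1 hB.compl.not_hFinite hs' ?_ Set.inter_subset_left
  refine (hs'.union hBC).mono fun x hx => ?_
  by_cases hxB : x ∈ B
  · exact Or.inr ⟨hxB, hx.2⟩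
  · exact Or.inl ⟨hxB, hx.1⟩

theorem SmallInter.congr {A A' B B' : Set G} (hA : Equivalent A A') (hB : Equivalent B B')
    (h : SmallInter A Bᶜ) : SmallInter A' B'ᶜ := by
  obtain ⟨H, K, h1, h2, -⟩ := id h
  have hA0 : Nontriv A := ⟨H, h1⟩
  have hB0 : Nontriv B := by simpa using (Nontriv.compl ⟨K, h2⟩)
  exact (((equivalent_iff_smallInter hA0 (hA0.of_equivalent hA)).1 hA).2.trans h).trans
    ((equivalent_iff_smallInter hB0 (hB0.of_equivalent hB)).1 hB).1

/-! ### The partial order -/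

/-- Once `A ∩ B*` is small, neither `A ∩ B` nor `A* ∩ B*` can be, as `A` or `B*` would then be small
too. Smallness of the remaining corner `A* ∩ B` means that `A` and `B` are equivalent. -/
theorem almostLE_iff {A B : Set G} (hA : Nontriv A) (hB : Nontriv B) :
    AlmostLE A B ↔ A ⊆ B ∨ (¬ Equivalent A B ∧ SmallInter A Bᶜ) := by
  have he := equivalent_iff_smallInter hA hB
  refine (or_congr Set.sdiff_eq_empty Iff.rfl).trans (or_congr_right ?_)
  constructor
  · rintro ⟨h1, h2, h3, h4⟩
    exact ⟨fun h => h3 (he.1 h).2.symm, h1⟩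
  · rintro ⟨h1, h2⟩
    refine ⟨h2, fun h => not_smallInter_compl h h2, fun h => h1 (he.2 ⟨h2, h.symm⟩), fun h => ?_⟩
    exact not_smallInter_compl h2.symm h.symm

theorem AlmostLE.smallInter {A B : Set G} (h : AlmostLE A B) (hA : Nontriv A)
    (hB : Nontriv B) : SmallInter A Bᶜ :=
  ((almostLE_iff hA hB).1 h).elim (smallInter_of_subset hA hB) And.right

theorem AlmostLE.subset {A B : Set G} (h : AlmostLE A B) (hA : Nontriv A)
    (hB : Nontriv B) (he : Equivalent A B) : A ⊆ B :=
  ((almostLE_iff hA hB).1 h).elim id fun h => (h.1 he).elim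

theorem isPartialOrder_almostLE {Y : Set G} (hY : Nontriv Y) :
    IsPartialOrder (E Y) (fun A B => AlmostLE (A : Set G) B) where
  refl A := Or.inl (Set.inter_compl_self _)
  antisymm A B h h' := by
    have hA := hY.of_mem_E A.2
    have hB := hY.of_mem_E B.2
    have he := (equivalent_iff_smallInter hA hB).2 ⟨h.smallInter hA hB, h'.smallInter hB hA⟩
    exact Subtype.ext ((h.subset hA hB he).antisymm (h'.subset hB hA (he.symm hA)))
  trans A B C h h' := by
    have hA := hY.of_mem_E A.2
    have hB := hY.of_mem_E B.2
    have hC := hY.of_mem_E C.2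
    have h1 := h.smallInter hA hB
    have h2 := h'.smallInter hB hC
    rw [almostLE_iff hA hC]
    -- If the two ends are equivalent, so is the middle set, and both relations are inclusions.
    by_cases he : Equivalent (A : Set G) C
    · have h3 := ((equivalent_iff_smallInter hA hC).1 he).2
      have e1 := (equivalent_iff_smallInter hA hB).2 ⟨h1, h2.trans h3⟩
      have e2 := (equivalent_iff_smallInter hB hC).2 ⟨h2, h3.trans h1⟩
      exact Or.inl ((h.subset hA hB e1).trans (h'.subset hB hC e2))
    · exact Or.inr ⟨he, h1.trans h2⟩

/-- Equivalent elements of `E(Y)` are nested if `Y` is in good position. -/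
theorem GoodPosition.subset_or_subset {Y A B : Set G} (hg : GoodPosition Y) (hY : Nontriv Y)
    (hA : A ∈ E Y) (hB : B ∈ E Y) (h : Equivalent A B) : A ⊆ B ∨ B ⊆ A := by
  have nA := hY.of_mem_E hA
  have nB := hY.of_mem_E hB
  obtain ⟨h1, h2⟩ := (equivalent_iff_smallInter nA nB).1 h
  obtain ⟨⟨i, j⟩, hi⟩ := hg A hA B hB
    ⟨(true, false), (false, true), by simp, by simpa [side] using h1,
      by simpa [side] using h2.symm⟩
  -- An empty corner other than the two small ones would make one of the sets or complements small.
  cases i <;> cases j <;> simp only [side, if_true, Bool.false_eq_true, if_false] at hi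
  · exact (not_smallInter_compl h2.symm (smallInter_of_eq_empty nA.compl nB.compl hi)).elim
  · rw [Set.inter_comm] at hi
    exact Or.inr (Set.sdiff_eq_empty.1 hi)
  · exact Or.inl (Set.sdiff_eq_empty.1 hi)
  · exact (not_smallInter_compl (smallInter_of_eq_empty nA nB hi) h1).elim

/-! Stabilizers -/

/-- The translates of `A` by elements of `L` are finite in number, so two powers of `g` give the
same one. -/
theorem exists_pow_smul_eq {K L : Subgroup G} {A : Set G} (hA : ∀ k ∈ K, k • A = A)
    (h : HFinite K (L : Set G)) {g : G} (hg : g ∈ L) : ∃ m : ℕ, 0 < m ∧ g ^ m • A = A := by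
  obtain ⟨F, hF, hs⟩ := h
  have hfin : ((fun f : G => f⁻¹ • A) '' F).Finite := hF.image _
  have hmem : ∀ n : ℕ, g ^ n • A ∈ (fun f : G => f⁻¹ • A) '' F := by
    intro n
    obtain ⟨f, hf, hm⟩ := mem_cosets.1 (hs (L.inv_mem (L.pow_mem hg n)))
    refine ⟨f, hf, ?_⟩
    have := hA _ (K.inv_mem hm)
    rw [mul_inv_rev, inv_inv, inv_inv, mul_smul] at this
    exact inv_smul_eq_iff.2 this.symm
  obtain ⟨i, j, hij, he⟩ := hfin.exists_lt_map_eq_of_forall_mem hmem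
  refine ⟨j - i, by omega, ?_⟩
  have hj : g ^ j = g ^ i * g ^ (j - i) := by rw [← pow_add]; congr 1; omega
  rw [hj, mul_smul] at he
  exact (smul_left_cancel _ he).symm

/-- The translates by successive powers form a monotone chain, which returns to `A` only if it is
constant. -/
theorem smul_eq_of_pow_smul_eq {A : Set G} {g : G} {m : ℕ} (hm : 0 < m) (h : g ^ m • A = A)
    (hc : g • A ⊆ A ∨ A ⊆ g • A) : g • A = A := by
  obtain ⟨n, rfl⟩ : ∃ n, m = n + 1 := ⟨m - 1, by omega⟩
  rcases hc with hc | hc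
  · refine hc.antisymm ?_
    have : ∀ n : ℕ, g ^ (n + 1) • A ⊆ g • A := by
      intro n
      induction n with
      | zero => simp
      | succ n ih =>
        rw [pow_succ, mul_smul]
        exact (Set.smul_set_mono hc).trans ih
    exact h.symm.subset.trans (this n)
  · refine Set.Subset.antisymm ?_ hc
    have : ∀ n : ℕ, g • A ⊆ g ^ (n + 1) • A := by
      intro n
      induction n with
      | zero => simp
      | succ n ih =>
        rw [pow_succ _ (n + 1), mul_smul]
        exact ih.trans (Set.smul_set_mono hc)
    exact (this n).trans h.subset

theorem smul_mem_E_self (Y : Set G) (g : G) : g • Y ∈ E Y := ⟨g, Or.inl rfl⟩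

theorem mem_E_self (Y : Set G) : Y ∈ E Y := ⟨1, Or.inl (one_smul _ _).symm⟩

theorem GoodPosition.smul_comparable {Z : Set G} (gZ : GoodPosition Z) (hZ : Nontriv Z) {g : G}
    (h : Equivalent (g • Z) Z) : g • Z ⊆ Z ∨ Z ⊆ g • Z :=
  gZ.subset_or_subset hZ (smul_mem_E_self Z g) (mem_E_self Z) h

theorem IsNontrivialAI.stabilizer {K : Subgroup G} {A : Set G} (h : IsNontrivialAI K A) :
    IsNontrivialAI (MulAction.stabilizer G A) A := by
  have hle : K ≤ MulAction.stabilizer G A := fun k hk => h.1.1 k hk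
  have hm : ∀ W, HFinite K W → HFinite (MulAction.stabilizer G A) W := by
    rintro W ⟨F, hF, hW⟩
    exact ⟨F, hF, hW.trans (Set.mul_subset_mul_right hle)⟩
  have hai : IsAI (MulAction.stabilizer G A) A :=
    isAI_iff.2 ⟨fun k hk => hk, fun a => hm _ ((isAI_iff.1 h.1).2 a)⟩
  exact h.of_almostEq hai (AlmostEq.refl _ _)

/-- An element that stabilizes a set equivalent to `Z` stabilizes `Z`, if `Z` is in good
position. -/
theorem GoodPosition.smul_eq {A Z : Set G} (gZ : GoodPosition Z) (hA : Nontriv A)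
    (h : Equivalent A Z) {g : G} (hg : g • A = A) : g • Z = Z := by
  have hZ := hA.of_equivalent h
  have e : Equivalent (g • Z) Z := by
    have := h.smul_congr hA (g := g) (k := 1)
    rw [hg, one_smul, one_smul] at this
    exact this (Equivalent.refl_of hA)
  obtain ⟨H, hA⟩ := hA
  obtain ⟨K, hZ'⟩ := id hZ
  have hf := (comm_aux hA.stabilizer hZ'.1 ((equivalent_iff hA.stabilizer hZ'.1).1 h)).1
  obtain ⟨m, hm, hp⟩ := exists_pow_smul_eq hZ'.1.1 hf (g := g) hg
  exact smul_eq_of_pow_smul_eq hm hp (gZ.smul_comparable hZ e)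

theorem GoodPosition.smul_eq_iff {Y Z : Set G} (gY : GoodPosition Y) (gZ : GoodPosition Z)
    (hY : Nontriv Y) (h : Equivalent Y Z) {g : G} : g • Y = Y ↔ g • Z = Z :=
  ⟨gZ.smul_eq hY h, gY.smul_eq (hY.of_equivalent h) (h.symm hY)⟩

/-- Elements that carry `Y` to a set equivalent to `Y` or to `Y*` normalize the stabilizer. -/
theorem GoodPosition.conj_smul_eq {Y : Set G} (gY : GoodPosition Y) (hY : Nontriv Y) {g s : G}
    (hg : Equivalent (g • Y) Y ∨ Equivalent (g • Y) Yᶜ) (hs : s • Y = Y) :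
    (g * s * g⁻¹) • Y = Y := by
  have h1 : (g * s * g⁻¹) • g • Y = g • Y := by
    rw [← mul_smul, inv_mul_cancel_right, mul_smul, hs]
  rcases hg with hg | hg
  · exact gY.smul_eq (hY.smul g) hg h1
  · refine gY.smul_eq (hY.smul g).compl (by simpa using hg.compl) ?_
    rw [Set.smul_set_compl, h1]

/-! The signed number of cosets between two almost equal sets -/

/-- Each of the six differences is split by the third set, and the pieces match up or cancel. -/
theorem ncard_sdiff_add {α : Type*} {a b c : Set α} (h1 : (a \ b).Finite) (h2 : (b \ a).Finite)
    (h3 : (b \ c).Finite) (h4 : (c \ b).Finite) :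
    ((a \ c).ncard : ℤ) - (c \ a).ncard =
      ((a \ b).ncard - (b \ a).ncard) + ((b \ c).ncard - (c \ b).ncard) := by
  have h5 : (a \ c).Finite := (h1.union h3).subset fun x hx => by
    by_cases hb : x ∈ b
    · exact Or.inr ⟨hb, hx.2⟩
    · exact Or.inl ⟨hx.1, hb⟩
  have h6 : (c \ a).Finite := (h4.union h2).subset fun x hx => by
    by_cases hb : x ∈ b
    · exact Or.inr ⟨hb, hx.2⟩
    · exact Or.inl ⟨hx.1, hb⟩
  rw [← Set.ncard_inter_add_ncard_sdiff_eq_ncard (a \ b) c h1,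
    ← Set.ncard_inter_add_ncard_sdiff_eq_ncard (b \ a) c h2,
    ← Set.ncard_inter_add_ncard_sdiff_eq_ncard (b \ c) a h3,
    ← Set.ncard_inter_add_ncard_sdiff_eq_ncard (c \ b) a h4,
    ← Set.ncard_inter_add_ncard_sdiff_eq_ncard (a \ c) b h5,
    ← Set.ncard_inter_add_ncard_sdiff_eq_ncard (c \ a) b h6,
    show (c \ b) ∩ a = (a \ b) ∩ c by grind, show (c \ a) ∩ b = (b \ a) ∩ c by grind,
    show (a \ c) ∩ b = (b \ c) ∩ a by grind, show (b \ c) \ a = (b \ a) \ c by grind,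
    show (a \ c) \ b = (a \ b) \ c by grind, show (c \ b) \ a = (c \ a) \ b by grind]
  push_cast
  ring

/-- The number of cosets of `S` in `A - B` minus the number of those in `B - A`. -/
noncomputable def signedCount (S : Subgroup G) (A B : Set G) : ℤ :=
  (cosetImage S (A \ B)).ncard - (cosetImage S (B \ A)).ncard

theorem cosetImage_sdiff {S : Subgroup G} {A B : Set G} (hA : ∀ s ∈ S, s • A = A)
    (hB : ∀ s ∈ S, s • B = B) : cosetImage S (A \ B) = cosetImage S A \ cosetImage S B := by
  have h : ∀ s ∈ S, s • (A \ B) = A \ B := fun s hs => by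
    rw [Set.smul_set_sdiff, hA s hs, hB s hs]
  ext q
  induction q using Quotient.inductionOn with | _ x => ?_
  rw [Set.mem_sdiff, mk_mem_cosetImage h, mk_mem_cosetImage hA, mk_mem_cosetImage hB, Set.mem_sdiff]

theorem AlmostEq.finite_left {S : Subgroup G} {A B : Set G} (h : AlmostEq S A B) :
    (cosetImage S (A \ B)).Finite :=
  hFinite_iff.1 (h.mono fun _ hx => Set.mem_symmDiff.2 (Or.inl hx))

theorem signedCount_add {S : Subgroup G} {A B C : Set G} (hA : ∀ s ∈ S, s • A = A)
    (hB : ∀ s ∈ S, s • B = B) (hC : ∀ s ∈ S, s • C = C) (h : AlmostEq S A B)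
    (h' : AlmostEq S B C) : signedCount S A C = signedCount S A B + signedCount S B C := by
  have h1 := h.finite_left
  have h2 := h.symm.finite_left
  have h3 := h'.finite_left
  have h4 := h'.symm.finite_left
  simp only [signedCount]
  rw [cosetImage_sdiff hA hB] at *
  rw [cosetImage_sdiff hB hA] at *
  rw [cosetImage_sdiff hB hC] at *
  rw [cosetImage_sdiff hC hB] at *
  rw [cosetImage_sdiff hA hC, cosetImage_sdiff hC hA]
  exact ncard_sdiff_add h1 h2 h3 h4

theorem signedCount_swap (S : Subgroup G) (A B : Set G) :
    signedCount S B A = - signedCount S A B := by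
  simp [signedCount]

theorem signedCount_compl (S : Subgroup G) (A B : Set G) :
    signedCount S Aᶜ Bᶜ = - signedCount S A B := by
  rw [signedCount, signedCount, compl_sdiff_compl, compl_sdiff_compl, neg_sub]

/-- Left multiplication by an element normalizing `S` permutes the cosets `S x`. -/
theorem ncard_cosetImage_smul {S : Subgroup G} {g : G} (hg : ∀ s, g * s * g⁻¹ ∈ S ↔ s ∈ S)
    (W : Set G) : (cosetImage S (g • W)).ncard = (cosetImage S W).ncard := by
  have key : ∀ x y : G, QuotientGroup.rightRel S (g * x) (g * y) ↔ QuotientGroup.rightRel S x y := by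
    intro x y
    rw [QuotientGroup.rightRel_apply, QuotientGroup.rightRel_apply, ← hg (y * x⁻¹)]
    simp [mul_assoc]
  let f : Quotient (QuotientGroup.rightRel S) → Quotient (QuotientGroup.rightRel S) :=
    Quotient.map (fun x => g * x) fun x y h => (key x y).2 h
  have hf : Function.Injective f := by
    intro p q
    induction p using Quotient.inductionOn with | _ x => ?_
    induction q using Quotient.inductionOn with | _ y => ?_
    intro h
    exact Quotient.sound ((key x y).1 (Quotient.exact h))
  have : cosetImage S (g • W) = f '' cosetImage S W := by
    rw [cosetImage, cosetImage, Set.image_image, ← Set.image_smul, Set.image_image]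
    rfl
  rw [this, Set.ncard_image_of_injective _ hf]

theorem signedCount_smul {S : Subgroup G} {g : G} (hg : ∀ s, g * s * g⁻¹ ∈ S ↔ s ∈ S)
    (A B : Set G) : signedCount S (g • A) (g • B) = signedCount S A B := by
  rw [signedCount, signedCount, ← Set.smul_set_sdiff, ← Set.smul_set_sdiff,
    ncard_cosetImage_smul hg, ncard_cosetImage_smul hg]

theorem signedCount_self (S : Subgroup G) (A : Set G) : signedCount S A A = 0 := by
  simp [signedCount]

theorem signedCount_nonneg {S : Subgroup G} {A B : Set G} (h : B ⊆ A) :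
    0 ≤ signedCount S A B := by
  simp [signedCount, cosetImage, Set.sdiff_eq_empty.2 h]

theorem eq_of_signedCount_nonpos {S : Subgroup G} {A B : Set G} (h : B ⊆ A)
    (hAB : AlmostEq S A B) (h0 : signedCount S A B ≤ 0) : A = B := by
  have hf := hAB.finite_left
  simp only [signedCount, Set.sdiff_eq_empty.2 h] at h0
  have h1 : (cosetImage S (A \ B)).ncard = 0 := by
    have : cosetImage S (∅ : Set G) = ∅ := Set.image_empty _
    rw [this, Set.ncard_empty] at h0
    omega
  rw [Set.ncard_eq_zero hf, cosetImage, Set.image_eq_empty, Set.sdiff_eq_empty] at h1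
  exact h1.antisymm h

theorem subset_iff_signedCount {S : Subgroup G} {A B : Set G} (h : B ⊆ A ∨ A ⊆ B)
    (hAB : AlmostEq S A B) : B ⊆ A ↔ 0 ≤ signedCount S A B := by
  refine ⟨signedCount_nonneg, fun h0 => h.elim id fun h1 => ?_⟩
  refine (eq_of_signedCount_nonpos h1 hAB.symm ?_).subset
  rw [signedCount_swap]
  omega

/-! Isomorphisms -/

/-- The bijection is `g Y₀ ↦ g Z`: `h1` makes it well defined and injective, `h2` gives complements,
and `h3` gives the order inside a class. Between inequivalent sets, `SmallInter.congr` suffices. -/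
theorem samePoset_of {Y Z Y₀ : Set G} (hY : Nontriv Y) (hY₀ : Y₀ ∈ E Y)
    (hE : ∀ A ∈ E Y, ∃ g : G, A = g • Y₀) (hE' : ∀ A ∈ E Z, ∃ g : G, A = g • Z)
    (e : Equivalent Y₀ Z) (h1 : ∀ g : G, g • Y₀ = Y₀ ↔ g • Z = Z)
    (h2 : ∀ g : G, g • Y₀ = Y₀ᶜ → g • Z = Zᶜ)
    (h3 : ∀ g : G, Equivalent (g • Y₀) Y₀ → (g • Y₀ ⊆ Y₀ ↔ g • Z ⊆ Z)) : SamePoset Y Z := by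
  have n := hY.of_mem_E hY₀
  have nZ := n.of_equivalent e
  have h1' : ∀ g k : G, g • Y₀ = k • Y₀ ↔ g • Z = k • Z := by
    intro g k
    rw [← inv_smul_eq_iff, ← mul_smul, h1, mul_smul, inv_smul_eq_iff]
  choose c hc using fun A : E Y => hE A A.2
  let φ : E Y → E Z := fun A => ⟨c A • Z, smul_mem_E_self Z _⟩
  have hφ : ∀ (A : E Y) (g : G), (A : Set G) = g • Y₀ → (φ A : Set G) = g • Z := by
    intro A g hg
    exact (h1' _ _).1 ((hc A).symm.trans hg)
  have hinj : Function.Injective φ := by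
    intro A B hAB
    apply Subtype.ext
    rw [hc A, hc B]
    exact (h1' _ _).2 (congrArg Subtype.val hAB)
  have hsurj : Function.Surjective φ := by
    intro B
    obtain ⟨g, hg⟩ := hE' B B.2
    refine ⟨⟨g • Y₀, smul_mem_E g hY₀⟩, Subtype.ext ?_⟩
    rw [hφ _ g rfl, hg]
  refine ⟨Equiv.ofBijective φ ⟨hinj, hsurj⟩, fun g A => Subtype.ext ?_, fun A => Subtype.ext ?_,
    fun A B => ?_, fun A => ?_⟩
  · change (φ (g • A) : Set G) = g • (φ A : Set G)
    rw [hφ (g • A) (g * c A), hφ A (c A) (hc A), mul_smul]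
    change g • (A : Set G) = _
    rw [mul_smul, ← hc A]
  · change (φ (starE A) : Set G) = (φ A : Set G)ᶜ
    obtain ⟨r, hr⟩ := hE _ (starE A).2
    rw [hφ _ r hr, hφ A (c A) (hc A), ← Set.smul_set_compl]
    have hr' : (A : Set G)ᶜ = r • Y₀ := hr
    have := h2 ((c A)⁻¹ * r) (by
      rw [mul_smul, ← hr', inv_smul_eq_iff, Set.smul_set_compl, ← hc A])
    rwa [mul_smul, inv_smul_eq_iff] at this
  · change _ ↔ AlmostLE (φ A : Set G) (φ B)
    have nA := n.smul (c A)
    have nB := n.smul (c B)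
    have nA' := nZ.smul (c A)
    have nB' := nZ.smul (c B)
    rw [hφ A _ (hc A), hφ B _ (hc B), hc A, hc B, almostLE_iff nA nB, almostLE_iff nA' nB']
    by_cases he : Equivalent (c A • Y₀) (c B • Y₀)
    · have he' := e.smul_congr n he
      have := h3 ((c B)⁻¹ * c A) ((equivalent_smul_smul_iff _ _).1 he)
      simp only [he, he', not_true, false_and, or_false]
      rwa [mul_smul, mul_smul, ← Set.subset_smul_set_iff, ← Set.subset_smul_set_iff] at this
    · have he' : ¬ Equivalent (c A • Z) (c B • Z) := fun hc =>
        he ((e.symm n).smul_congr nZ hc)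
      simp only [he, he', not_false_eq_true, true_and]
      rw [or_iff_right_of_imp (smallInter_of_subset nA nB),
        or_iff_right_of_imp (smallInter_of_subset nA' nB')]
      exact ⟨SmallInter.congr (e.smul _) (e.smul _),
        SmallInter.congr ((e.smul _).symm nA) ((e.smul _).symm nB)⟩
  · change Equivalent (A : Set G) (φ A)
    rw [hφ A _ (hc A)]
    conv_lhs => rw [hc A]
    exact e.smul _

/-! The shift homomorphism -/

theorem equivalent_inv_smul {Y : Set G} (hY : Nontriv Y) {g : G} (h : Equivalent (g • Y) Y) :
    Equivalent (g⁻¹ • Y) Y := by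
  have := h.smul g⁻¹
  rw [inv_smul_smul] at this
  exact this.symm hY

theorem equivalent_inv_smul_compl {Y : Set G} (hY : Nontriv Y) {g : G}
    (h : Equivalent (g • Y) Yᶜ) : Equivalent (g⁻¹ • Y) Yᶜ := by
  have := (h.smul g⁻¹).compl
  rw [inv_smul_smul, Set.smul_set_compl, compl_compl] at this
  exact this.symm hY.compl

theorem equivalent_mul_smul {Y : Set G} (hY : Nontriv Y) {g k : G} (h : Equivalent (g • Y) Y)
    (h' : Equivalent (k • Y) Y) : Equivalent ((g * k) • Y) Y := by
  rw [mul_smul]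
  exact (h'.smul g).trans h ((hY.smul k).smul g)

theorem mem_stabilizer_conj_iff {Y : Set G} (gY : GoodPosition Y) (hY : Nontriv Y) {g : G}
    (hg : Equivalent (g • Y) Y ∨ Equivalent (g • Y) Yᶜ) (s : G) :
    g * s * g⁻¹ ∈ MulAction.stabilizer G Y ↔ s ∈ MulAction.stabilizer G Y := by
  refine ⟨fun h => ?_, fun h => gY.conj_smul_eq hY hg h⟩
  have := gY.conj_smul_eq hY
    (hg.imp (equivalent_inv_smul hY) (equivalent_inv_smul_compl hY)) h
  simpa [mul_assoc] using this

theorem smul_smul_eq_of_conj {S : Subgroup G} {A : Set G} {g : G}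
    (hg : ∀ s, g * s * g⁻¹ ∈ S ↔ s ∈ S) (hA : ∀ s ∈ S, s • A = A) :
    ∀ s ∈ S, s • g • A = g • A := by
  intro s hs
  have h : g * (g⁻¹ * s * g) * g⁻¹ ∈ S := by simpa [mul_assoc] using hs
  have := hA _ ((hg _).1 h)
  rwa [mul_smul, mul_smul, inv_smul_eq_iff] at this

theorem Equivalent.almostEq_stabilizer {Y A : Set G} (h : Equivalent Y A) (hY : Nontriv Y) :
    AlmostEq (MulAction.stabilizer G Y) Y A := by
  obtain ⟨K, hY⟩ := hY
  obtain ⟨-, L, -, hA, -⟩ := id h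
  exact (equivalent_iff hY.stabilizer hA).1 h

/-- The signed number of cosets of the stabilizer of `Y` between `Y` and `k Y`. -/
noncomputable def shift (Y : Set G) (k : G) : ℤ :=
  signedCount (MulAction.stabilizer G Y) Y (k • Y)

/-- Going from `A` to `kA` through `Y` and `kY`, the first and last contributions cancel, since `k`
normalizes the stabilizer. So the shift depends only on the class. -/
theorem signedCount_eq_shift {Y A : Set G} (gY : GoodPosition Y) (hY : Nontriv Y)
    (hA : ∀ s ∈ MulAction.stabilizer G Y, s • A = A) (e : Equivalent Y A) {k : G}
    (hk : Equivalent (k • Y) Y) :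
    signedCount (MulAction.stabilizer G Y) A (k • A) = shift Y k := by
  have hn := mem_stabilizer_conj_iff gY hY (Or.inl hk)
  have hY0 : ∀ s ∈ MulAction.stabilizer G Y, s • Y = Y := fun s hs => hs
  have hkY := smul_smul_eq_of_conj hn hY0
  have hkA := smul_smul_eq_of_conj hn hA
  have hk' := hk.symm (hY.smul k)
  have e1 := e.almostEq_stabilizer hY
  have e2 := hk'.almostEq_stabilizer hY
  have e3 := (hk'.trans (e.smul k) hY).almostEq_stabilizer hY
  rw [signedCount_add hA hY0 hkA e1.symm e3, signedCount_add hY0 hkY hkA e2 (e2.symm.trans e3),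
    signedCount_smul hn, signedCount_swap _ Y A, shift]
  ring

theorem shift_mul {Y : Set G} (gY : GoodPosition Y) (hY : Nontriv Y) {k l : G}
    (hk : Equivalent (k • Y) Y) (hl : Equivalent (l • Y) Y) :
    shift Y (k * l) = shift Y k + shift Y l := by
  have hn := mem_stabilizer_conj_iff gY hY (Or.inl hk)
  have hY0 : ∀ s ∈ MulAction.stabilizer G Y, s • Y = Y := fun s hs => hs
  have hkY := smul_smul_eq_of_conj hn hY0
  have hkl := smul_smul_eq_of_conj
    (mem_stabilizer_conj_iff gY hY (Or.inl (equivalent_mul_smul hY hk hl))) hY0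
  have e1 := (hk.symm (hY.smul k)).almostEq_stabilizer hY
  have e2 := ((equivalent_mul_smul hY hk hl).symm (hY.smul _)).almostEq_stabilizer hY
  rw [shift, signedCount_add hY0 hkY hkl e1 (e1.symm.trans e2), mul_smul, signedCount_smul hn]
  rfl

theorem shift_eq_zero_of_smul_eq {Y : Set G} {k : G} (h : k • Y = Y) : shift Y k = 0 := by
  rw [shift, h, signedCount_self]

theorem shift_inv {Y : Set G} (gY : GoodPosition Y) (hY : Nontriv Y) {k : G}
    (hk : Equivalent (k • Y) Y) : shift Y k⁻¹ = - shift Y k := by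
  have := shift_mul gY hY hk (equivalent_inv_smul hY hk)
  rw [mul_inv_cancel, shift_eq_zero_of_smul_eq (one_smul _ _)] at this
  omega

/-- Applying `r⁻¹` turns the left side into the count from `r⁻¹Y` to `k r⁻¹Y`. The complement of
`r⁻¹Y` is equivalent to `Y`, and complementation changes the sign. -/
theorem shift_conj {Y : Set G} (gY : GoodPosition Y) (hY : Nontriv Y) {r k : G}
    (hr : Equivalent (r • Y) Yᶜ) (hk : Equivalent (k • Y) Y) :
    shift Y (r * k * r⁻¹) = - shift Y k := by
  have hr' := equivalent_inv_smul_compl hY hr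
  have hn := mem_stabilizer_conj_iff gY hY (Or.inr hr')
  have hn' := mem_stabilizer_conj_iff gY hY (Or.inr hr)
  have hY0 : ∀ s ∈ MulAction.stabilizer G Y, s • Y = Y := fun s hs => hs
  have hW := smul_smul_eq_of_conj hn hY0
  have h1 : ∀ s ∈ MulAction.stabilizer G Y, s • (r⁻¹ • Y)ᶜ = (r⁻¹ • Y)ᶜ := fun s hs => by
    rw [Set.smul_set_compl, hW s hs]
  have h2 : Equivalent Y (r⁻¹ • Y)ᶜ := by
    have := hr'.compl
    rw [compl_compl] at this
    exact this.symm (hY.smul _).compl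
  rw [← signedCount_eq_shift gY hY h1 h2 hk, Set.smul_set_compl, signedCount_compl, neg_neg,
    ← signedCount_smul hn', smul_inv_smul, shift, mul_smul, mul_smul]

theorem smul_eq_of_shift_eq_zero {Y : Set G} (gY : GoodPosition Y) (hY : Nontriv Y) {k : G}
    (hk : Equivalent (k • Y) Y) (h : shift Y k = 0) : k • Y = Y := by
  have e := (hk.symm (hY.smul k)).almostEq_stabilizer hY
  rcases gY.smul_comparable hY hk with h1 | h1
  · exact (eq_of_signedCount_nonpos h1 e h.le).symm
  · refine eq_of_signedCount_nonpos h1 e.symm ?_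
    rw [signedCount_swap]
    exact (neg_eq_zero.2 h).le

/-! ### Comparing two equivalent sets in good position -/

theorem stabilizer_eq {Y Z : Set G} (gY : GoodPosition Y) (gZ : GoodPosition Z) (hY : Nontriv Y)
    (e : Equivalent Y Z) : MulAction.stabilizer G Y = MulAction.stabilizer G Z := by
  ext g
  exact gY.smul_eq_iff gZ hY e

theorem shift_congr {Y Z : Set G} (gY : GoodPosition Y) (gZ : GoodPosition Z) (hY : Nontriv Y)
    (e : Equivalent Y Z) {k : G} (hk : Equivalent (k • Y) Y) : shift Z k = shift Y k := by
  have hS := stabilizer_eq gY gZ hY e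
  rw [← signedCount_eq_shift gY hY (fun s hs => by rw [hS] at hs; exact hs) e hk, hS, shift]

theorem smul_compl_of_inv {Y : Set G} {r : G} (h : r • Y = Yᶜ) : r⁻¹ • Y = Yᶜ := by
  rw [inv_smul_eq_iff, Set.smul_set_compl, h, compl_compl]

theorem exists_eq_smul {Y A : Set G} (hr : IsInvertible Y) (hA : A ∈ E Y) :
    ∃ g : G, A = g • Y := by
  obtain ⟨r, hr⟩ := hr
  obtain ⟨g, rfl | rfl⟩ := hA
  · exact ⟨g, rfl⟩
  · exact ⟨g * r, by rw [mul_smul, hr]⟩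

/-- The product of inverting elements for `Y` and `Z` preserves the class of `Y`. -/
theorem equivalent_inv_mul_smul {Y Z : Set G} (hY : Nontriv Y) (e : Equivalent Y Z) {r t : G}
    (hr : r • Y = Yᶜ) (ht : t • Z = Zᶜ) : Equivalent ((r⁻¹ * t) • Y) Y := by
  have h1 : Equivalent (t • Y) Yᶜ := by
    have h2 := e.smul t
    rw [ht] at h2
    exact h2.trans (e.compl.symm hY.compl) (hY.smul t)
  have h3 := h1.smul r⁻¹
  rwa [Set.smul_set_compl, smul_compl_of_inv hr, compl_compl, ← mul_smul] at h3

/-- The numerical condition says that `t` inverts `kY`, so `kY` serves as a base point of `E(Y)`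
matching `Z`. -/
theorem samePoset_of_shift {Y Z : Set G} (gY : GoodPosition Y) (gZ : GoodPosition Z)
    (hY : Nontriv Y) (e : Equivalent Y Z) {r t k : G} (hr : r • Y = Yᶜ) (ht : t • Z = Zᶜ)
    (hk : Equivalent (k • Y) Y) (h : shift Y (r⁻¹ * t) + 2 * shift Y k = 0) :
    SamePoset Y Z := by
  have hZ := hY.of_equivalent e
  have hr' : Equivalent (r⁻¹ • Y) Yᶜ := by
    rw [smul_compl_of_inv hr]
    exact Equivalent.refl_of hY.compl
  have hk' := equivalent_inv_smul hY hk
  have hrt := equivalent_inv_mul_smul hY e hr ht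
  have hstab : ∀ g : G, g • k • Y = k • Y ↔ g • Y = Y := fun g => by
    refine ⟨gY.smul_eq (hY.smul k) hk, fun hg => ?_⟩
    have := gY.conj_smul_eq hY (Or.inl hk') hg
    rwa [inv_inv, mul_smul, mul_smul, inv_smul_eq_iff] at this
  have htk : t • k • Y = (k • Y)ᶜ := by
    have hc : Equivalent ((r⁻¹ * k⁻¹ * r⁻¹⁻¹) • Y) Y := by
      rw [inv_inv, mul_smul, hr, mul_smul, Set.smul_set_compl, Set.smul_set_compl]
      have h2 := (hk'.smul r⁻¹).trans hr' ((hY.smul _).smul _)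
      simpa using h2.compl
    -- This element is `r⁻¹k⁻¹tk`, which fixes `Y` exactly when `t` inverts `kY`. Conjugation by
    -- `r⁻¹` negates the shift of `k⁻¹`, so `shift Y k` occurs twice.
    have h0 : shift Y (r⁻¹ * k⁻¹ * r⁻¹⁻¹ * (r⁻¹ * t) * k) = 0 := by
      rw [shift_mul gY hY (equivalent_mul_smul hY hc hrt) hk, shift_mul gY hY hc hrt,
        shift_conj gY hY hr' hk', shift_inv gY hY hk]
      omega
    have h1 := smul_eq_of_shift_eq_zero gY hY
      (equivalent_mul_smul hY (equivalent_mul_smul hY hc hrt) hk) h0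
    rw [show r⁻¹ * k⁻¹ * r⁻¹⁻¹ * (r⁻¹ * t) * k = r⁻¹ * (k⁻¹ * (t * k)) by group, mul_smul,
      inv_smul_eq_iff, hr, mul_smul, inv_smul_eq_iff, mul_smul, Set.smul_set_compl] at h1
    exact h1
  have hkY : k • Y ∈ E Y := smul_mem_E_self Y k
  refine samePoset_of (Y₀ := k • Y) hY hkY (fun A hA => ?_)
    (fun A hA => exists_eq_smul ⟨t, ht⟩ hA) (hk.trans e (hY.smul k)) (fun g => ?_) (fun g hg => ?_)
    (fun g hg => ?_)
  · obtain ⟨g, rfl⟩ := exists_eq_smul ⟨r, hr⟩ hA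
    exact ⟨g * k⁻¹, by rw [mul_smul, inv_smul_smul]⟩
  · rw [hstab, gY.smul_eq_iff gZ hY e]
  · rw [← htk, ← inv_smul_eq_iff, ← mul_smul, hstab, gY.smul_eq_iff gZ hY e, mul_smul,
      inv_smul_eq_iff, ht] at hg
    exact hg
  · have hg' : Equivalent (g • Y) Y := by
      have := hk.smul_congr (hY.smul k) (g := g) (k := 1)
      rw [one_smul, one_smul] at this
      exact this hg
    have hgZ : Equivalent (g • Z) Z := by
      have := e.smul_congr hY (g := g) (k := 1)
      rw [one_smul, one_smul] at this
      exact this hg'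
    have e1 := (hk.symm (hY.smul k)).almostEq_stabilizer hY
    have e2 := (((hg.trans hk ((hY.smul k).smul g)).symm
      ((hY.smul k).smul g))).almostEq_stabilizer hY
    have e3 := (hgZ.symm (hZ.smul g)).almostEq_stabilizer hZ
    have hs : ∀ s ∈ MulAction.stabilizer G Y, s • k • Y = k • Y := fun s hs =>
      (hstab s).2 hs
    -- Both inclusions become `0 ≤ shift Y g`.
    rw [subset_iff_signedCount (gY.subset_or_subset hY (smul_mem_E g hkY) hkY hg) (e1.symm.trans e2),
      subset_iff_signedCount (gZ.smul_comparable hZ hgZ) e3,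
      signedCount_eq_shift gY hY hs (hk.symm (hY.smul k)) hg', ← shift_congr gY gZ hY e hg', shift]

/-! ### Parity of the shifts -/

/-- The values of the shift homomorphism. -/
def shiftRange {Y : Set G} (gY : GoodPosition Y) (hY : Nontriv Y) : AddSubgroup ℤ where
  carrier := {n | ∃ k : G, Equivalent (k • Y) Y ∧ shift Y k = n}
  zero_mem' := ⟨1, by rw [one_smul]; exact Equivalent.refl_of hY,
    shift_eq_zero_of_smul_eq (one_smul _ _)⟩
  add_mem' := by
    rintro _ _ ⟨k, hk, rfl⟩ ⟨l, hl, rfl⟩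
    exact ⟨k * l, equivalent_mul_smul hY hk hl, shift_mul gY hY hk hl⟩
  neg_mem' := by
    rintro _ ⟨k, hk, rfl⟩
    exact ⟨k⁻¹, equivalent_inv_smul hY hk, shift_inv gY hY hk⟩

/-- The shifts of `r⁻¹t` and `t⁻¹u` are multiples `a m`, `b m` of a generator of the range, and that
of `r⁻¹u` is `(a + b) m`. One of `a`, `b`, `a + b` is even. -/
theorem samePoset_pigeonhole {Y Z V : Set G} (hY : Nontriv Y) (eZ : Equivalent Y Z)
    (eV : Equivalent Y V) (gY : GoodPosition Y) (gZ : GoodPosition Z) (gV : GoodPosition V)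
    (iY : IsInvertible Y) (iZ : IsInvertible Z) (iV : IsInvertible V) :
    SamePoset Y Z ∨ SamePoset Y V ∨ SamePoset Z V := by
  obtain ⟨r, hr⟩ := iY
  obtain ⟨t, ht⟩ := iZ
  obtain ⟨u, hu⟩ := iV
  have hZ := hY.of_equivalent eZ
  have eZV : Equivalent Z V := (eZ.symm hY).trans eV hZ
  have hrt := equivalent_inv_mul_smul hY eZ hr ht
  have hru := equivalent_inv_mul_smul hY eV hr hu
  have htu := equivalent_inv_mul_smul hZ eZV ht hu
  have toZ : ∀ {k : G}, Equivalent (k • Y) Y → Equivalent (k • Z) Z := fun {k} hk => by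
    have := eZ.smul_congr hY (g := k) (k := 1)
    rw [one_smul, one_smul] at this
    exact this hk
  have htu' : Equivalent ((t⁻¹ * u) • Y) Y := by
    have := (eZ.symm hY).smul_congr hZ (g := t⁻¹ * u) (k := 1)
    rw [one_smul, one_smul] at this
    exact this htu
  have hsum : shift Y (r⁻¹ * u) = shift Y (r⁻¹ * t) + shift Y (t⁻¹ * u) := by
    rw [← shift_mul gY hY hrt htu', mul_assoc, mul_inv_cancel_left]
  obtain ⟨m, hm⟩ := Int.subgroup_cyclic (shiftRange gY hY)
  have mem : ∀ n : ℤ, (∃ k : G, Equivalent (k • Y) Y ∧ shift Y k = n) ↔ ∃ a : ℤ, a • m = n := by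
    intro n
    rw [← AddSubgroup.mem_closure_singleton, ← hm]
    rfl
  have half : ∀ n a b : ℤ, a • m = n → a = b + b →
      ∃ k : G, Equivalent (k • Y) Y ∧ n + 2 * shift Y k = 0 := by
    intro n a b h1 h2
    obtain ⟨k, hk, hs⟩ := (mem ((-b) • m)).2 ⟨-b, rfl⟩
    refine ⟨k, hk, ?_⟩
    rw [hs, ← h1, h2]
    simp only [smul_eq_mul]
    ring
  obtain ⟨a, ha⟩ := (mem _).1 ⟨_, hrt, rfl⟩
  obtain ⟨b, hb⟩ := (mem _).1 ⟨_, htu', rfl⟩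
  have hab : (a + b) • m = shift Y (r⁻¹ * u) := by rw [add_smul, ha, hb, hsum]
  rcases Int.even_or_odd a with ⟨c, hc⟩ | ha'
  · obtain ⟨k, hk, h⟩ := half _ a c ha hc
    exact Or.inl (samePoset_of_shift gY gZ hY eZ hr ht hk h)
  rcases Int.even_or_odd b with ⟨c, hc⟩ | hb'
  · obtain ⟨k, hk, h⟩ := half _ b c hb hc
    rw [← shift_congr gY gZ hY eZ hk, ← shift_congr gY gZ hY eZ htu'] at h
    exact Or.inr (Or.inr (samePoset_of_shift gZ gV hZ eZV ht hu (toZ hk) h))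
  · obtain ⟨c, hc⟩ := ha'.add_odd hb'
    obtain ⟨k, hk, h⟩ := half _ _ c hab hc
    exact Or.inr (Or.inl (samePoset_of_shift gY gV hY eV hr hu hk h))

/-! ### The finite index case -/

/-- A power of `k` lies in `H`, and a further power fixes `Y` by commensurability. As `kY` and `Y`
are nested, `k` itself fixes `Y`. -/
theorem smul_eq_of_finiteIndex {H : Subgroup G} {X Y : Set G} (hX : IsNontrivialAI H X)
    (e : Equivalent X Y) (gY : GoodPosition Y) (hf : (H.subgroupOf (stabK hX)).FiniteIndex)
    {k : G} (hk : Equivalent (k • Y) Y) : k • Y = Y := by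
  have nX : Nontriv X := ⟨H, hX⟩
  have hY := nX.of_equivalent e
  have hkX : Equivalent (k • X) X := by
    have := (e.symm nX).smul_congr hY (g := k) (k := 1)
    rw [one_smul, one_smul] at this
    exact this hk
  obtain ⟨n, hn, -, hkn⟩ := Subgroup.exists_pow_mem_of_index_ne_zero hf.index_ne_zero
    (⟨k, Or.inl hkX⟩ : stabK hX)
  have hkn' : k ^ n ∈ H := hkn
  obtain ⟨-, K, -, hK, -⟩ := id e
  obtain ⟨m, hm, h⟩ := exists_pow_smul_eq hK.1
    (comm_aux hX hK ((equivalent_iff hX hK).1 e)).1 hkn'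
  rw [← pow_mul] at h
  exact smul_eq_of_pow_smul_eq (Nat.mul_pos hn hm) h (gY.smul_comparable hY hk)

theorem samePoset_of_finiteIndex {H : Subgroup G} {X Y Z : Set G} (hX : IsNontrivialAI H X)
    (eY : Equivalent X Y) (eZ : Equivalent X Z) (gY : GoodPosition Y) (gZ : GoodPosition Z)
    (iY : IsInvertible Y) (iZ : IsInvertible Z)
    (hf : (H.subgroupOf (stabK hX)).FiniteIndex) : SamePoset Y Z := by
  have nX : Nontriv X := ⟨H, hX⟩
  have hY := nX.of_equivalent eY
  have e : Equivalent Y Z := (eY.symm nX).trans eZ hY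
  obtain ⟨r, hr⟩ := iY
  obtain ⟨t, ht⟩ := iZ
  refine samePoset_of_shift gY gZ hY e hr ht (k := 1) ?_ ?_
  · rw [one_smul]
    exact Equivalent.refl_of hY
  · rw [shift_eq_zero_of_smul_eq (one_smul G Y), shift_eq_zero_of_smul_eq
      (smul_eq_of_finiteIndex hX eY gY hf (equivalent_inv_mul_smul hY e hr ht))]
    rfl

end AlmostInvariant

theorem mainTheorem6 {G : Type*} [Group G] [Group.FG G] (H : Subgroup G) (hH : H.FG)
    (X Y Z V : Set G) (hX : IsNontrivialAI H X)
    (hY : Equivalent X Y) (hZ : Equivalent X Z) (hV : Equivalent X V)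
    (gY : GoodPosition Y) (gZ : GoodPosition Z) (gV : GoodPosition V)
    (iY : IsInvertible Y) (iZ : IsInvertible Z)
    (iV : IsInvertible V) :
    (IsPartialOrder (E Y) (fun A B => AlmostLE (A : Set G) B) ∧
      IsPartialOrder (E Z) (fun A B => AlmostLE (A : Set G) B) ∧
      IsPartialOrder (E V) (fun A B => AlmostLE (A : Set G) B)) ∧
    ((SamePoset Y Z ∧ SamePoset Y V ∧ SamePoset Z V) ∨
      (¬ (H.subgroupOf (stabK hX)).FiniteIndex ∧
        (SamePoset Y Z ∨ SamePoset Y V ∨ SamePoset Z V))) := by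
  have nX : Nontriv X := ⟨H, hX⟩
  have nY := nX.of_equivalent hY
  refine ⟨⟨isPartialOrder_almostLE nY, isPartialOrder_almostLE (nX.of_equivalent hZ),
    isPartialOrder_almostLE (nX.of_equivalent hV)⟩, ?_⟩
  by_cases hf : (H.subgroupOf (stabK hX)).FiniteIndex
  · exact Or.inl ⟨samePoset_of_finiteIndex hX hY hZ gY gZ iY iZ hf,
      samePoset_of_finiteIndex hX hY hV gY gV iY iV hf,
      samePoset_of_finiteIndex hX hZ hV gZ gV iZ iV hf⟩
  · exact Or.inr ⟨hf, samePoset_pigeonhole nY ((hY.symm nX).trans hZ nY)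
      ((hY.symm nX).trans hV nY) gY gZ gV iY iZ iV⟩
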